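/- All alphabets are finite. A pushdown automaton (PDA) $\mathcal A$ over $\Sigma$ has a finite state set $Q$ with an initial state $q_0$ and a set $F\subseteq Q$ of final states, a finite stack alphabet $\Gamma$ containing a bottom symbol $\bot$, and a finite set of rules $pX\stackrel{l}{\to}q\alpha$ with $p,q\in Q$, $X\in\Gamma$, $l\in\Sigma\cup\{\varepsilon\}$, $\alpha\in(\Gamma\setminus\{\bot\})^*$. Configurations are $q\gamma\bot$ with $\gamma\in(\Gamma\setminus\{\bot\})^*$. A rule with $X\ne\bot$ gives the step $pX\gamma\bot\to q\alpha\gamma\bot$ with label $l$, and a rule with $X=\bot$ gives the step $p\bot\to q\alpha\bot$ with label $l$ (the bottom symbol is never removed). A word $w\in\Sigma^*$ is accepted if some path from $q_0\bot$ to a configuration with state in $F$ has a label that projects to $w$ on $\Sigma$. $\mathcal A$ is *realtime* if no rule has $l=\varepsilon$. It is *deterministic* if for all $p,X,l$ there is at most one rule $pX\stackrel{l}{\to}q\alpha$, and whenever there is a rule $pX\stackrel{\varepsilon}{\to}q\alpha$ there is no rule $pX\stackrel{a}{\to}q'\alpha'$ with $a\in\Sigma$. It is *normalized* if (1) every $w\in\Sigma^*$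 labels (after projection) some path from $q_0\bot$; (2) for each state $p$, either all rules from $p$ have $l\in\Sigma$ or all have $l=\varepsilon$; (3) every rule replaces its top symbol $X$ by $\varepsilon$, $X$ or $YX$ for some $Y\in\Gamma\setminus\{\bot\}$ (for $X=\bot$: by $\bot$ or $Y\bot$). It is *height-deterministic* if it is normalized and, for every sequence $w$ of labels in $\Sigma\cup\{\varepsilon\}$, all paths from $q_0\bot$ labelled exactly by $w$ end with the same stack height. DPDA, RDPDA and HRDPDA denote the families of languages recognized by, respectively, deterministic, realtime deterministic, and height-deterministic realtime deterministic PDAs. A context-free grammar $G$ with nonterminals $V_N$ is an *operator grammar* if no right part of a rule has two adjacent nonterminals. For $A\in V_N$ put $\mathcal L(A)=\{a\in\Sigma\mid A\Rightarrow^* Ba\alpha\}$ and $\mathcal R(A)=\{a\in\Sigma\mid A\Rightarrow^*\alpha aB\}$, where $B\in V_N\cup\{\varepsilon\}$ and $\alpha\in(V_N\cup\Sigma)^*$. For $a,b\in\Sigma$ define: $a\doteq b$ iff some rule has the form $A\to\alpha aBb\beta$ with $B\in V_N\cup\{\varepsilon\}$; $a\gtrdot b$ iff some rule has the form $A\to\alpha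 Db\beta$ with $D\in V_N$ and $a\in\mathcal R(D)$; $a\lessdot b$ iff some rule has the form $A\to\alpha aD\beta$ with $D\in V_N$ and $b\in\mathcal L(D)$. $G$ is a *Floyd grammar* if it is an operator grammar and for all $a,b\in\Sigma$ at most one of these three relations holds between $a$ and $b$. FG denotes the family of languages generated by Floyd grammars. **Proposition.** The families FG and HRDPDA are incomparable: neither is contained in the other. More precisely: 1. Over every alphabet containing distinct letters $a,b,c,d,e$, the language $L_1=\{a^mb^nc^nd^m\mid m,n\ge1\}\cup\{a^mb^ned^m\mid m,n\ge1\}$ is in FG, is in DPDA, and is not in RDPDA; in particular it is not in HRDPDA. 2. Over every alphabet containing distinct letters $a,c$, the language $L_2=\{a^nca^n\mid n\ge0\}$ is in HRDPDA and is not in FG. -/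

import Mathlib

/-! ## Pushdown automata -/

/-- A pushdown automaton over the terminal alphabet `T`. `Stack` is the stack alphabet without the
bottom symbol `⊥`. A rule `(p, X, l, q, α)` stands for `p X --l--> q α`, where the top symbol `X` is
`none` for `⊥` and `some Y` for an ordinary symbol, the label `l` is `none` for the empty word and
`some a` for a letter, and `α` contains no `⊥`. -/
structure PDA (T : Type) where
  State : Type
  Stack : Type
  finite_state : Finite State
  finite_stack : Finite Stack
  rules : Set (State × Option Stack × Option T × State × List Stack)
  finite_rules : rules.Finite
  start : State
  final : Set State

namespace PDA

variable {T : Type} (A : PDA T)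

/-- A pair `(q, γ)` is the configuration `q γ ⊥`; the head of `γ` is the top of the stack. -/
abbrev Config : Type := A.State × List A.Stack

/-- The labelled transition system on the configurations `q γ ⊥`. A rule for an ordinary top symbol
replaces that symbol by `α`; a rule for `⊥` writes `α` above `⊥`, which always stays in place. -/
inductive Step : Option T → A.Config → A.Config → Prop
  | top {p q : A.State} {X : A.Stack} {l : Option T} {α : List A.Stack} (γ : List A.Stack) :
      (p, some X, l, q, α) ∈ A.rules → Step l (p, X :: γ) (q, α ++ γ)
  | bottom {p q : A.State} {l : Option T} {α : List A.Stack} :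
      (p, none, l, q, α) ∈ A.rules → Step l (p, []) (q, α)

/-- Finite paths, labelled by words over letters and explicit empty-word labels. -/
inductive Path : List (Option T) → A.Config → A.Config → Prop
  | nil (x : A.Config) : Path [] x x
  | cons {l : Option T} {w : List (Option T)} {x y z : A.Config} :
      A.Step l x y → Path w y z → Path (l :: w) x z

/-- `x ⟹ y` on the word `w`: some path from `x` to `y` whose label projects to `w`. -/
def Reaches (w : List T) (x y : A.Config) : Prop :=
  ∃ v : List (Option T), A.Path v x y ∧ v.reduceOption = w

/-- The initial configuration `q₀ ⊥`. -/
def init : A.Config := (A.start, [])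

/-- The recognized language (acceptance by final state, with any stack). -/
def language : Language T :=
  {w : List T | ∃ p ∈ A.final, ∃ γ : List A.Stack, A.Reaches w A.init (p, γ)}

/-- No rule reads the empty word. -/
def Realtime : Prop :=
  ∀ p X l q α, (p, X, l, q, α) ∈ A.rules → l ≠ none

def Deterministic : Prop :=
  (∀ p X l, {x : A.State × List A.Stack | (p, X, l, x.1, x.2) ∈ A.rules}.Subsingleton) ∧
  (∀ p X q α l r β, (p, X, none, q, α) ∈ A.rules → (p, X, l, r, β) ∈ A.rules → l = none)

/-- Every word can be read from the initial configuration. -/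
def Complete : Prop :=
  ∀ w : List T, ∃ x : A.Config, A.Reaches w A.init x

/-- For a rule with top symbol `X`, the new stack top is `ε`, `X` or `Y X`. Since `⊥` always stays,
for `X = ⊥` this leaves `⊥` and `Y ⊥`. -/
def NormalForm : Option A.Stack → List A.Stack → Prop
  | some X, α => α = [] ∨ α = [X] ∨ ∃ Y, α = [Y, X]
  | none, α => α = [] ∨ ∃ Y, α = [Y]

structure Normalized : Prop where
  complete : A.Complete
  uniform : ∀ p : A.State,
    (∀ X l q α, (p, X, l, q, α) ∈ A.rules → l ≠ none) ∨
    (∀ X l q α, (p, X, l, q, α) ∈ A.rules → l = none)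
  form : ∀ p X l q α, (p, X, l, q, α) ∈ A.rules → A.NormalForm X α

/-- The set of stack heights (not counting `⊥`) reached after reading `w`. -/
def heights (w : List (Option T)) : Set ℕ :=
  {n | ∃ (q : A.State) (γ : List A.Stack), A.Path w A.init (q, γ) ∧ γ.length = n}

structure HeightDeterministic : Prop where
  normalized : A.Normalized
  heights_subsingleton : ∀ w : List (Option T), (A.heights w).Subsingleton

end PDA

/-- Languages of deterministic pushdown automata. -/
def DPDA (T : Type) : Set (Language T) :=
  {L | ∃ A : PDA T, A.Deterministic ∧ A.language = L}

/-- Languages of realtime deterministic pushdown automata. -/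
def RDPDA (T : Type) : Set (Language T) :=
  {L | ∃ A : PDA T, A.Realtime ∧ A.Deterministic ∧ A.language = L}

/-- Languages of height-deterministic realtime deterministic pushdown automata. -/
def HRDPDA (T : Type) : Set (Language T) :=
  {L | ∃ A : PDA T, A.HeightDeterministic ∧ A.Realtime ∧ A.Deterministic ∧ A.language = L}

/-! ## Floyd (operator precedence) grammars -/

/-- The three operator precedence relations `≐`, `⋗`, `⋖`. -/
inductive OPRel
  | doteq
  | gtrdot
  | lessdot

namespace ContextFreeGrammar

variable {T : Type} (G : ContextFreeGrammar T)

/-- The string consisting of an optional nonterminal, that is, an element of `V_N ∪ {ε}`. -/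
def optNT (B : Option G.NT) : List (Symbol T G.NT) := B.toList.map Symbol.nonterminal

/-- No right part has two adjacent nonterminals. -/
def IsOperator : Prop :=
  ∀ r ∈ G.rules, ∀ (α β : List (Symbol T G.NT)) (A B : G.NT),
    r.output ≠ α ++ [Symbol.nonterminal A, Symbol.nonterminal B] ++ β

/-- The left terminal set: letters `a` with `A ⇒* B a α`, `B ∈ V_N ∪ {ε}`. -/
def leftTerminals (A : G.NT) : Set T :=
  {a | ∃ (B : Option G.NT) (α : List (Symbol T G.NT)),
    G.Derives [Symbol.nonterminal A] (G.optNT B ++ [Symbol.terminal a] ++ α)}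

/-- The right terminal set: letters `a` with `A ⇒* α a B`, `B ∈ V_N ∪ {ε}`. -/
def rightTerminals (A : G.NT) : Set T :=
  {a | ∃ (B : Option G.NT) (α : List (Symbol T G.NT)),
    G.Derives [Symbol.nonterminal A] (α ++ [Symbol.terminal a] ++ G.optNT B)}

/-- `G.Prec ρ a b`: the precedence relation `ρ` holds between the letters `a` and `b`. -/
def Prec : OPRel → T → T → Prop
  | .doteq, a, b => ∃ r ∈ G.rules, ∃ (α β : List (Symbol T G.NT)) (B : Option G.NT),
      r.output = α ++ [Symbol.terminal a] ++ G.optNT B ++ [Symbol.terminal b] ++ β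
  | .gtrdot, a, b => ∃ r ∈ G.rules, ∃ (α β : List (Symbol T G.NT)) (D : G.NT),
      r.output = α ++ [Symbol.nonterminal D, Symbol.terminal b] ++ β ∧ a ∈ G.rightTerminals D
  | .lessdot, a, b => ∃ r ∈ G.rules, ∃ (α β : List (Symbol T G.NT)) (D : G.NT),
      r.output = α ++ [Symbol.terminal a, Symbol.nonterminal D] ++ β ∧ b ∈ G.leftTerminals D

/-- The operator precedence matrix. -/
def opm (a b : T) : Set OPRel := {ρ | G.Prec ρ a b}

/-- A Floyd grammar: an operator grammar whose precedence matrix is conflict-free, that is, every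
entry has at most one element. -/
def IsFloyd : Prop :=
  G.IsOperator ∧ ∀ a b : T, (G.opm a b).Subsingleton

end ContextFreeGrammar

/-- Languages of Floyd grammars. -/
def FG (T : Type) : Set (Language T) :=
  {L | ∃ G : ContextFreeGrammar T, G.IsFloyd ∧ G.language = L}

/-! ## The two witnesses -/

/-- `{aᵐ bⁿ cⁿ dᵐ | m, n ≥ 1} ∪ {aᵐ bⁿ e dᵐ | m, n ≥ 1}`. -/
def witness₁ {T : Type} (a b c d e : T) : Language T :=
  {w : List T | ∃ m n : ℕ, 1 ≤ m ∧ 1 ≤ n ∧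
    (w = List.replicate m a ++ List.replicate n b ++ List.replicate n c ++ List.replicate m d ∨
     w = List.replicate m a ++ List.replicate n b ++ [e] ++ List.replicate m d)}

/-- `{aⁿ c aⁿ | n ≥ 0}`. -/
def witness₂ {T : Type} (a c : T) : Language T :=
  {w : List T | ∃ n : ℕ, w = List.replicate n a ++ [c] ++ List.replicate n a}

/-! The positive claims are settled by an explicit grammar and two explicit automata; the two
negative ones carry the theorem.

`aⁿcaⁿ` is not Floyd: in a derivation tree of such a word, follow the branch leading to `c`. Suppose
`a ⋖ a` fails. Then no right part on this branch has an `a` directly before a nonterminal whose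
yield starts with `a`, and the operator form forbids a nonterminal there. So all letters `a` before
`c` come from a prefix of one single right part. The letters after `c` fix `n`, so this prefix
generates words of length `n` only; as there are finitely many such prefixes, `n` is bounded. Hence
`a ⋖ a` (`lessdot_of_language_eq_witness₂`). The language is closed under reversal, so the reversed
grammar gives `a ⋗ a` as well, a conflict.

`witness₁` is not realtime deterministic: while the letters `b` are read after `aᵐ`, the
configurations are pairwise distinct, because their number must be matched by the letters `c`. So
the stack grows without bound, and from some moment on it never sinks below its current top symbol
(`exists_min_height`). Two different values of `m` share state and top symbol at that moment, and
from there the same upper stack is built over different lower stacks (`exists_upper_run`). Once the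
upper part is high enough, a realtime automaton reading `e dᵐ` cannot get beneath it
(`Path.exists_of_length_le`), so it confuses the two values. With empty moves the letters `b` can be
discarded after `e`, which is how the general deterministic automaton succeeds. -/

/-! ### Big-step derivations and least yields -/

namespace ContextFreeGrammar

variable {T : Type} {G : ContextFreeGrammar T}

/-- Big-step semantics of a grammar: the string `s` of symbols generates the word `w`. -/
inductive Yields (G : ContextFreeGrammar T) : List (Symbol T G.NT) → List T → Prop
  | nil : Yields G [] []
  | terminal (t : T) {s : List (Symbol T G.NT)} {w : List T} :
      Yields G s w → Yields G (Symbol.terminal t :: s) (t :: w)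
  | nonterminal {r : ContextFreeRule T G.NT} {s : List (Symbol T G.NT)} {u w : List T} :
      r ∈ G.rules → Yields G r.output u → Yields G s w →
        Yields G (Symbol.nonterminal r.input :: s) (u ++ w)

namespace Yields

variable {s s' : List (Symbol T G.NT)} {u w : List T}

lemma append (h : G.Yields s u) (h' : G.Yields s' w) : G.Yields (s ++ s') (u ++ w) := by
  induction h with
  | nil => exact h'
  | terminal t _ ih => exact .terminal t ih
  | nonterminal hr hu _ _ ih =>
    rw [List.append_assoc]
    exact .nonterminal hr hu ih

lemma eq_nil (h : G.Yields [] w) : w = [] := by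
  cases h; rfl

lemma exists_of_append (h : G.Yields (s ++ s') w) :
    ∃ u v, w = u ++ v ∧ G.Yields s u ∧ G.Yields s' v := by
  induction s generalizing w with
  | nil => exact ⟨[], w, rfl, .nil, h⟩
  | cons x s ih =>
    cases h with
    | terminal t h =>
      obtain ⟨u, v, rfl, hu, hv⟩ := ih h
      exact ⟨t :: u, v, rfl, .terminal t hu, hv⟩
    | nonterminal hr hy h =>
      obtain ⟨u, v, rfl, hu, hv⟩ := ih h
      exact ⟨_, v, (List.append_assoc _ _ _).symm, .nonterminal hr hy hu, hv⟩

lemma singleton_terminal (t : T) : G.Yields [Symbol.terminal t] [t] := .terminal t .nil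

lemma singleton_nonterminal {r : ContextFreeRule T G.NT} (hr : r ∈ G.rules)
    (h : G.Yields r.output w) : G.Yields [Symbol.nonterminal r.input] w := by
  simpa using Yields.nonterminal hr h .nil

lemma map_terminal (w : List T) : G.Yields (w.map Symbol.terminal) w := by
  induction w with
  | nil => exact .nil
  | cons t w ih => exact .terminal t ih

lemma derives (h : G.Yields s w) : G.Derives s (w.map Symbol.terminal) := by
  induction h with
  | nil => exact Derives.refl _
  | terminal t _ ih => exact ih.append_left [Symbol.terminal t]
  | @nonterminal r s u w hr _ _ ih₁ ih₂ =>
    have h₁ : G.Produces (Symbol.nonterminal r.input :: s) (r.output ++ s) :=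
      ⟨r, hr, .head s⟩
    rw [List.map_append]
    exact h₁.trans_derives ((ih₁.append_right s).trans (ih₂.append_left _))

/-- Induction from the front of the derivation: undoing one rewriting step regroups the part of the
word generated by the right part under its nonterminal. -/
lemma of_derives (h : G.Derives s s') (hw : G.Yields s' w) : G.Yields s w := by
  induction h using Relation.ReflTransGen.head_induction_on with
  | refl => exact hw
  | head h _ ih =>
    obtain ⟨r, hr, h⟩ := h
    obtain ⟨p, q, rfl, rfl⟩ := h.exists_parts
    obtain ⟨x, z, rfl, hx, hz⟩ := ih.exists_of_append
    obtain ⟨x, y, rfl, hx, hy⟩ := hx.exists_of_append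
    exact (hx.append (singleton_nonterminal hr hy)).append hz

end Yields

lemma mem_language_iff_yields {w : List T} :
    w ∈ G.language ↔ G.Yields [Symbol.nonterminal G.initial] w :=
  ⟨fun h => .of_derives h (.map_terminal w), fun h => h.derives⟩

/-- The least length of a word generated by `s`. -/
noncomputable def minYield (s : List (Symbol T G.NT)) : ℕ :=
  sInf {n | ∃ w, G.Yields s w ∧ w.length = n}

lemma minYield_eq {s : List (Symbol T G.NT)} {n : ℕ} {w : List T} (hw : G.Yields s w)
    (h : ∀ w', G.Yields s w' → w'.length = n) : minYield s = n := by
  have : {n | ∃ w, G.Yields s w ∧ w.length = n} = {n} := by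
    ext k
    constructor
    · rintro ⟨w', hw', rfl⟩
      exact h w' hw'
    · rintro rfl
      exact ⟨w, hw, h w hw⟩
  rw [minYield, this, csInf_singleton]

/-- The least yields of the prefixes of right parts of rules are bounded. -/
lemma exists_minYield_le (G : ContextFreeGrammar T) :
    ∃ K, ∀ r ∈ G.rules, ∀ α β, r.output = α ++ β → minYield α ≤ K := by
  -- Finitely many rules, each with finitely many prefixes `take i`. A prefix that generates no word
  -- contributes `sInf ∅ = 0`.
  refine ⟨G.rules.sup fun r =>
    (Finset.range (r.output.length + 1)).sup fun i => minYield (G := G) (r.output.take i), ?_⟩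
  intro r hr α β h
  have h₁ : minYield α = minYield (G := G) (r.output.take α.length) := by simp [h]
  rw [h₁]
  refine le_trans ?_ (Finset.le_sup (f := fun r : ContextFreeRule T G.NT =>
    (Finset.range (r.output.length + 1)).sup fun i => minYield (G := G) (r.output.take i)) hr)
  exact Finset.le_sup (f := fun i => minYield (G := G) (r.output.take i))
    (Finset.mem_range.2 (by simp [h]))

end ContextFreeGrammar

/-! ### The language `aⁿcaⁿ` has no Floyd grammar -/

section Witness₂

variable {T : Type} {a c : T}

lemma append_cons_eq_replicate {n : ℕ} (hac : a ≠ c) {x z : List T}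
    (h : x ++ c :: z = List.replicate n a ++ [c] ++ List.replicate n a) :
    x = List.replicate n a ∧ z = List.replicate n a := by
  have hx : c ∉ List.replicate n a := fun h => hac (List.eq_of_mem_replicate h).symm
  rw [List.append_assoc, List.append_eq_append_iff] at h
  rcases h with ⟨k, h₁, h₂⟩ | ⟨k, h₁, h₂⟩
  · cases k with
    | nil => simp_all
    | cons t k =>
      rw [List.cons_append, List.cons.injEq] at h₂
      exact absurd (h₁ ▸ h₂.1 ▸ by simp) hx
  · cases k with
    | nil => simp_all
    | cons t k =>
      rw [List.singleton_append, List.cons_append, List.cons.injEq] at h₂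
      exact absurd (h₂.2 ▸ by simp) hx

open ContextFreeGrammar in
/-- In an operator grammar for `aⁿ c aⁿ`, the letter `a` yields precedence to itself. -/
lemma lessdot_of_language_eq_witness₂ (hac : a ≠ c) {G : ContextFreeGrammar T}
    (hG : G.IsOperator) (hL : G.language = witness₂ a c) : G.Prec .lessdot a a := by
  by_contra hlt
  obtain ⟨K, hK⟩ := exists_minYield_le G
  -- If `α` generates everything before `c`, then the fixed remainder `c aⁿ` forces every yield of
  -- `α` to be `aⁿ`, so `n` is the least yield of `α`.
  have bound : ∀ r ∈ G.rules, ∀ (α s : List (Symbol T G.NT)) (n : ℕ) (z : List T),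
      r.output = α ++ s → G.Yields α (List.replicate n a) →
      z = List.replicate n a → (∀ y, G.Yields α y → y ++ c :: z ∈ witness₂ a c) → n ≤ K := by
    intro r hr α s n z hout hα hz hctx
    rw [← minYield_eq hα (n := n)]
    · exact hK r hr α s hout
    · intro w hw
      obtain ⟨m, hm⟩ := hctx w hw
      obtain ⟨h₁, h₂⟩ := append_cons_eq_replicate hac hm
      have := congrArg List.length (hz.symm.trans h₂)
      simp only [List.length_replicate] at this
      simp [h₁, this]
  -- Descent along the branch leading to `c`. The right part of `r` starts at the left end of the
  -- whole word: `α` is the part already scanned, with yield `x`, and `v` is the context on the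
  -- right. Descending into a nonterminal is only needed when `α` is empty, so the left context
  -- remains empty.
  have key : ∀ (s : List (Symbol T G.NT)) (w : List T), G.Yields s w →
      ∀ r ∈ G.rules, ∀ (α : List (Symbol T G.NT)) (x v : List T) (n : ℕ),
        r.output = α ++ s → G.Yields α x →
        (∀ y, G.Yields r.output y → y ++ v ∈ witness₂ a c) →
        x ++ w ++ v = List.replicate n a ++ [c] ++ List.replicate n a → c ∈ w → n ≤ K := by
    intro s w h
    induction h with
    | nil => simp
    | @terminal t s w hs ih =>
      intro r hr α x v n hout hα hctx hw hc
      by_cases htc : t = c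
      · subst htc
        simp only [List.append_assoc, List.cons_append] at hw
        obtain ⟨h₁, h₂⟩ := append_cons_eq_replicate hac (by simpa using hw)
        refine bound r hr α _ n (w ++ v) hout (h₁ ▸ hα) h₂ fun y hy => ?_
        have := hctx (y ++ t :: w) (by rw [hout]; exact hy.append (.terminal t hs))
        simpa using this
      · refine ih r hr (α ++ [.terminal t]) (x ++ [t]) v n (by simp [hout])
          (hα.append (.singleton_terminal t)) hctx (by simpa using hw) ?_
        simpa [Ne.symm htc] using hc
    | @nonterminal r' s u w hr' hu hs ih₁ ih₂ =>
      intro r hr α x v n hout hα hctx hw hc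
      by_cases hcu : c ∈ u
      · rcases List.eq_nil_or_concat' α with rfl | ⟨α', X, rfl⟩
        · obtain rfl := hα.eq_nil
          refine ih₁ r' hr' [] [] (w ++ v) n rfl .nil (fun y hy => ?_) (by simpa using hw) hcu
          have := hctx (y ++ w) (by rw [hout]; exact .nonterminal hr' hy hs)
          simpa using this
        · rcases X with t | B
          · obtain ⟨x, y, rfl, hx, hy⟩ := hα.exists_of_append
            obtain rfl : y = [t] := by
              cases hy with
              | terminal _ h => rw [h.eq_nil]
            obtain ⟨u₁, u₂, rfl⟩ := List.append_of_mem hcu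
            obtain ⟨h₁, h₂⟩ := append_cons_eq_replicate (n := n) hac
              (x := x ++ [t] ++ u₁) (z := u₂ ++ w ++ v) (by simpa using hw)
            have hmem : ∀ b ∈ x ++ [t] ++ u₁, b = a := fun b hb =>
              List.eq_of_mem_replicate (h₁ ▸ hb)
            obtain rfl : t = a := hmem t (by simp)
            cases u₁ with
            -- The nonterminal's yield starts with `c` itself, so `α` generates all of `aⁿ`.
            | nil =>
              refine bound r hr _ _ n (u₂ ++ w ++ v) hout
                (by rw [← h₁]; simpa using hα) h₂ fun y hy => ?_
              have := hctx (y ++ (c :: u₂ ++ w))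
                (by rw [hout]; exact hy.append (.nonterminal hr' hu hs))
              simpa using this
            | cons b u₁ =>
              obtain rfl : b = t := hmem b (by simp)
              -- Here `a` stands directly before a nonterminal whose yield starts with `a`, which is
              -- `a ⋖ a`.
              refine absurd ⟨r, hr, α', s, r'.input, by simp [hout], none,
                (u₁ ++ c :: u₂).map .terminal, ?_⟩ hlt
              simpa [optNT] using (Yields.singleton_nonterminal hr' hu).derives
          · exact absurd (by simpa using hout) (hG r hr α' s B r'.input)
      · refine ih₂ r hr (α ++ [.nonterminal r'.input]) (x ++ u) v n (by simp [hout])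
          (hα.append (.singleton_nonterminal hr' hu)) hctx (by simpa using hw) ?_
        simpa [hcu] using hc
  have hmem : List.replicate (K + 1) a ++ [c] ++ List.replicate (K + 1) a ∈ G.language := by
    rw [hL]
    exact ⟨K + 1, rfl⟩
  rw [mem_language_iff_yields] at hmem
  generalize hs : [Symbol.nonterminal G.initial] = s at hmem
  generalize hw : List.replicate (K + 1) a ++ [c] ++ List.replicate (K + 1) a = w at hmem
  cases hmem with
  | nil => simp at hs
  | terminal => simp at hs
  | @nonterminal r s u w hr hu hs' =>
    simp only [List.cons.injEq, Symbol.nonterminal.injEq] at hs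
    obtain ⟨hr₁, rfl⟩ := hs
    obtain rfl := hs'.eq_nil
    have := key _ _ hu r hr [] [] [] (K + 1) rfl .nil (fun y hy => ?_) (by simpa using hw.symm) ?_
    · omega
    · rw [← hL, List.append_nil, mem_language_iff_yields, hr₁]
      exact .singleton_nonterminal hr hy
    · rw [List.append_nil] at hw
      simp [← hw]

namespace ContextFreeGrammar

variable {G : ContextFreeGrammar T}

lemma reverse_mem_rules {r : ContextFreeRule T G.reverse.NT} (hr : r ∈ G.reverse.rules) :
    (r.reverse : ContextFreeRule T G.NT) ∈ G.rules := by
  obtain ⟨r', h', rfl⟩ := Finset.mem_map.1 hr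
  exact (ContextFreeRule.reverse_reverse r').symm ▸ h'

lemma IsOperator.reverse (hG : G.IsOperator) : G.reverse.IsOperator := by
  intro r hr α β A B h
  exact hG _ (reverse_mem_rules hr) β.reverse α.reverse B A (by
    simp only [ContextFreeRule.reverse, h, List.reverse_append]
    exact (List.append_assoc _ _ _).symm)

lemma reverse_optNT_append (B : Option G.NT) (t : T) (γ : List (Symbol T G.NT)) :
    (G.optNT B ++ [Symbol.terminal t] ++ γ).reverse =
      γ.reverse ++ [Symbol.terminal t] ++ G.optNT B := by
  cases B <;> simp [optNT]

/-- Reversal exchanges left and right terminal sets, hence `⋖` and `⋗` with their arguments swapped.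
-/
lemma gtrdot_of_reverse_lessdot {b : T} (h : G.reverse.Prec .lessdot a b) :
    G.Prec .gtrdot b a := by
  obtain ⟨r, hr, α, β, D, hout, B, γ, hD⟩ := h
  refine ⟨_, reverse_mem_rules hr, β.reverse, α.reverse, D, ?_, B, γ.reverse, ?_⟩
  · simp only [ContextFreeRule.reverse, hout, List.reverse_append]
    exact (List.append_assoc _ _ _).symm
  · have := derives_reverse_comm.1 hD
    exact reverse_optNT_append B b γ ▸ this

end ContextFreeGrammar

lemma witness₂_reverse : (witness₂ a c).reverse = witness₂ a c := by
  ext w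
  rw [Language.mem_reverse]
  constructor
  · rintro ⟨n, h⟩
    exact ⟨n, by rw [← List.reverse_reverse w, h]; simp⟩
  · rintro ⟨n, rfl⟩
    exact ⟨n, by simp⟩

theorem witness₂_notMem_FG (hac : a ≠ c) : witness₂ a c ∉ FG T := by
  rintro ⟨G, ⟨hG, hconf⟩, hL⟩
  have h₁ : OPRel.lessdot ∈ G.opm a a := lessdot_of_language_eq_witness₂ hac hG hL
  have h₂ : OPRel.gtrdot ∈ G.opm a a := ContextFreeGrammar.gtrdot_of_reverse_lessdot
    (lessdot_of_language_eq_witness₂ hac hG.reverse (by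
      rw [ContextFreeGrammar.language_reverse, hL, witness₂_reverse]))
  exact absurd (hconf a a h₁ h₂) (by simp)

end Witness₂

/-! ### A Floyd grammar for `witness₁` -/

namespace ContextFreeGrammar

variable {T : Type} {G : ContextFreeGrammar T}

/-- The concatenation of the languages that `L` assigns to the symbols of a string. -/
def concatLanguage {N : Type} (L : N → Language T) : List (Symbol T N) → Language T
  | [] => 1
  | .terminal t :: s => {[t]} * concatLanguage L s
  | .nonterminal A :: s => L A * concatLanguage L s

/-- Languages that are closed under the rules contain all generated words. -/
lemma Yields.mem_concatLanguage {L : G.NT → Language T}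
    (hL : ∀ r ∈ G.rules, concatLanguage L r.output ≤ L r.input)
    {s : List (Symbol T G.NT)} {w : List T} (h : G.Yields s w) : w ∈ concatLanguage L s := by
  induction h with
  | nil => exact rfl
  | terminal t _ ih => exact ⟨[t], rfl, _, ih, rfl⟩
  | nonterminal hr _ _ ih₁ ih₂ => exact ⟨_, hL _ hr ih₁, _, ih₂, rfl⟩

/-- A property of strings that is preserved by rewriting is preserved by derivations. -/
lemma Derives.invariant {P : List (Symbol T G.NT) → Prop}
    (hP : ∀ r ∈ G.rules, ∀ p q, P (p ++ [Symbol.nonterminal r.input] ++ q) →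
      P (p ++ r.output ++ q))
    {s s' : List (Symbol T G.NT)} (h : G.Derives s s') (hs : P s) : P s' := by
  induction h with
  | refl => exact hs
  | tail _ h ih =>
    obtain ⟨r, hr, h⟩ := h
    obtain ⟨p, q, rfl, rfl⟩ := h.exists_parts
    exact hP r hr p q ih

end ContextFreeGrammar

namespace Witness₁

inductive NT
  | S | X | Y

open NT Symbol ContextFreeGrammar

variable {T : Type} (a b c d e : T)

open Classical in
/-- The rules `S → aSd | aXd | aYd`, `X → bXc | bc`, `Y → bY | be`. -/
noncomputable def rules : Finset (ContextFreeRule T NT) :=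
  {⟨S, [terminal a, nonterminal S, terminal d]⟩,
    ⟨S, [terminal a, nonterminal X, terminal d]⟩,
    ⟨S, [terminal a, nonterminal Y, terminal d]⟩,
    ⟨X, [terminal b, nonterminal X, terminal c]⟩,
    ⟨X, [terminal b, terminal c]⟩,
    ⟨Y, [terminal b, nonterminal Y]⟩,
    ⟨Y, [terminal b, terminal e]⟩}

/-- A Floyd grammar for the language `witness₁`. -/
noncomputable def grammar : ContextFreeGrammar T where
  NT := NT
  initial := S
  rules := rules a b c d e

variable {a b c d e}

lemma mem_rules {r : ContextFreeRule T NT} : r ∈ rules a b c d e ↔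
    r = ⟨S, [terminal a, nonterminal S, terminal d]⟩ ∨
    r = ⟨S, [terminal a, nonterminal X, terminal d]⟩ ∨
    r = ⟨S, [terminal a, nonterminal Y, terminal d]⟩ ∨
    r = ⟨X, [terminal b, nonterminal X, terminal c]⟩ ∨
    r = ⟨X, [terminal b, terminal c]⟩ ∨
    r = ⟨Y, [terminal b, nonterminal Y]⟩ ∨
    r = ⟨Y, [terminal b, terminal e]⟩ := by
  simp [rules]

variable (a b c d e)

/-- The languages of the three nonterminals. -/
def nonterminalLanguage : NT → Language T
  | S => witness₁ a b c d e
  | X => {w | ∃ n, 1 ≤ n ∧ w = List.replicate n b ++ List.replicate n c}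
  | Y => {w | ∃ n, 1 ≤ n ∧ w = List.replicate n b ++ [e]}

lemma language_grammar : (grammar a b c d e).language = witness₁ a b c d e := by
  ext w
  rw [mem_language_iff_yields]
  constructor
  · intro h
    have := h.mem_concatLanguage (L := nonterminalLanguage a b c d e) ?_
    · obtain ⟨u, hu, v, rfl, rfl⟩ := this
      change u ++ [] ∈ _
      rwa [List.append_nil]
    · intro r hr
      rcases mem_rules.1 hr with rfl | rfl | rfl | rfl | rfl | rfl | rfl
      · rintro _ ⟨_, rfl, _, ⟨_, ⟨m, n, hm, hn, h⟩, _, ⟨_, rfl, _, rfl, rfl⟩, rfl⟩, rfl⟩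
        refine ⟨m + 1, n, by omega, hn, ?_⟩
        rcases h with rfl | rfl
        · left; simp [List.replicate_succ' (a := d), List.replicate_succ (a := a)]
        · right; simp [List.replicate_succ' (a := d), List.replicate_succ (a := a)]
      · rintro _ ⟨_, rfl, _, ⟨_, ⟨n, hn, rfl⟩, _, ⟨_, rfl, _, rfl, rfl⟩, rfl⟩, rfl⟩
        exact ⟨1, n, le_rfl, hn, .inl (by simp)⟩
      · rintro _ ⟨_, rfl, _, ⟨_, ⟨n, hn, rfl⟩, _, ⟨_, rfl, _, rfl, rfl⟩, rfl⟩, rfl⟩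
        exact ⟨1, n, le_rfl, hn, .inr (by simp)⟩
      · rintro _ ⟨_, rfl, _, ⟨_, ⟨n, hn, rfl⟩, _, ⟨_, rfl, _, rfl, rfl⟩, rfl⟩, rfl⟩
        exact ⟨n + 1, by omega,
          by simp [List.replicate_succ' (a := c), List.replicate_succ (a := b)]⟩
      · rintro _ ⟨_, rfl, _, ⟨_, rfl, _, rfl, rfl⟩, rfl⟩
        exact ⟨1, le_rfl, by simp⟩
      · rintro _ ⟨_, rfl, _, ⟨_, ⟨n, hn, rfl⟩, _, rfl, rfl⟩, rfl⟩
        exact ⟨n + 1, by omega, by simp [List.replicate_succ (a := b)]⟩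
      · rintro _ ⟨_, rfl, _, ⟨_, rfl, _, rfl, rfl⟩, rfl⟩
        exact ⟨1, le_rfl, by simp⟩
  · have hterm : ∀ t : T, (grammar a b c d e).Yields [terminal t] [t] := .singleton_terminal
    have hX : ∀ n, (grammar a b c d e).Yields [nonterminal X]
        (List.replicate (n + 1) b ++ List.replicate (n + 1) c) := by
      intro n
      induction n with
      | zero =>
        exact .singleton_nonterminal (r := ⟨X, _⟩)
          (mem_rules.2 (.inr (.inr (.inr (.inr (.inl rfl)))))) ((hterm b).append (hterm c))
      | succ n ih =>
        have := Yields.singleton_nonterminal (r := ⟨X, _⟩)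
          (mem_rules.2 (.inr (.inr (.inr (.inl rfl)))))
          (((hterm b).append ih).append (hterm c))
        rw [List.replicate_succ' (a := c) (n := n + 1), List.replicate_succ (a := b) (n := n + 1)]
        simpa using this
    have hY : ∀ n, (grammar a b c d e).Yields [nonterminal Y]
        (List.replicate (n + 1) b ++ [e]) := by
      intro n
      induction n with
      | zero =>
        exact .singleton_nonterminal (r := ⟨Y, _⟩)
          (mem_rules.2 (.inr (.inr (.inr (.inr (.inr (.inr rfl))))))) ((hterm b).append (hterm e))
      | succ n ih =>
        exact Yields.singleton_nonterminal (r := ⟨Y, _⟩)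
          (mem_rules.2 (.inr (.inr (.inr (.inr (.inr (.inl rfl))))))) ((hterm b).append ih)
    have hS : ∀ u, ((grammar a b c d e).Yields [nonterminal X] u ∨
        (grammar a b c d e).Yields [nonterminal Y] u) → ∀ m,
        (grammar a b c d e).Yields [nonterminal S]
          (List.replicate (m + 1) a ++ u ++ List.replicate (m + 1) d) := by
      intro u hu m
      induction m with
      | zero =>
        rcases hu with hu | hu
        · exact .singleton_nonterminal (r := ⟨S, _⟩)
            (mem_rules.2 (.inr (.inl rfl))) (((hterm a).append hu).append (hterm d))
        · exact .singleton_nonterminal (r := ⟨S, _⟩)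
            (mem_rules.2 (.inr (.inr (.inl rfl)))) (((hterm a).append hu).append (hterm d))
      | succ m ih =>
        have := Yields.singleton_nonterminal (r := ⟨S, _⟩)
          (mem_rules.2 (.inl rfl)) (((hterm a).append ih).append (hterm d))
        rw [List.replicate_succ' (a := d) (n := m + 1), List.replicate_succ (a := a) (n := m + 1)]
        simpa using this
    rintro ⟨m, n, hm, hn, h⟩
    obtain ⟨m, rfl⟩ := Nat.exists_eq_add_of_le' hm
    obtain ⟨n, rfl⟩ := Nat.exists_eq_add_of_le' hn
    rcases h with rfl | rfl
    · have := hS _ (.inl (hX n)) m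
      rwa [← List.append_assoc] at this
    · have := hS _ (.inr (hY n)) m
      rwa [← List.append_assoc] at this

lemma isOperator_grammar : (grammar a b c d e).IsOperator := by
  have key : ∀ r ∈ rules a b c d e, ∀ (α β : List (Symbol T NT)) (A B : NT),
      r.output ≠ α ++ [nonterminal A, nonterminal B] ++ β := by
    intro r hr α β A B h
    rcases mem_rules.1 hr with rfl | rfl | rfl | rfl | rfl | rfl | rfl <;>
      rcases α with _ | ⟨_, _ | ⟨_, _ | ⟨_, _⟩⟩⟩ <;> simp at h
  exact key

/-- The first letter of every string that a nonterminal derives. -/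
def firstLetter : NT → T
  | S => a
  | X => b
  | Y => b

/-- The last letters of strings that a nonterminal derives. -/
def lastLetters : NT → Set T
  | S => {d}
  | X => {c}
  | Y => {b, e}

lemma output_eq_cons {r : ContextFreeRule T NT} (hr : r ∈ rules a b c d e) :
    ∃ s, r.output = terminal (firstLetter a b r.input) :: s := by
  rcases mem_rules.1 hr with rfl | rfl | rfl | rfl | rfl | rfl | rfl <;> exact ⟨_, rfl⟩

lemma output_eq_append {r : ContextFreeRule T NT} (hr : r ∈ rules a b c d e) :
    (∃ s, ∃ t ∈ lastLetters b c d e r.input, r.output = s ++ [terminal t]) ∨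
      (r.input = Y ∧ ∃ s, r.output = s ++ [terminal b] ++ [nonterminal Y]) := by
  rcases mem_rules.1 hr with rfl | rfl | rfl | rfl | rfl | rfl | rfl
  · exact .inl ⟨[_, _], d, rfl, rfl⟩
  · exact .inl ⟨[_, _], d, rfl, rfl⟩
  · exact .inl ⟨[_, _], d, rfl, rfl⟩
  · exact .inl ⟨[_, _], c, rfl, rfl⟩
  · exact .inl ⟨[_], c, rfl, rfl⟩
  · exact .inr ⟨rfl, [], rfl⟩
  · exact .inl ⟨[_], e, .inr rfl, rfl⟩

/-- Every right part begins with a terminal, so the first rewriting step settles the first letter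
for good. -/
lemma leftTerminals_subset (A : NT) {t : T}
    (ht : t ∈ (grammar a b c d e).leftTerminals A) : t = firstLetter a b A := by
  let P (s : List (Symbol T NT)) : Prop :=
    s = [nonterminal A] ∨ ∃ s', s = terminal (firstLetter a b A) :: s'
  have hP : ∀ r ∈ rules a b c d e, ∀ p q, P (p ++ [nonterminal r.input] ++ q) →
      P (p ++ r.output ++ q) := by
    rintro r hr (_ | ⟨x, p⟩) q (h | ⟨s', h⟩)
    · obtain ⟨s, hs⟩ := output_eq_cons a b c d e hr
      simp at h
      exact .inr ⟨s ++ q, by simp [hs, h]⟩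
    · simp at h
    · simp at h
    · simp at h
      exact .inr ⟨p ++ r.output ++ q, by simp [h]⟩
  obtain ⟨B, α, h⟩ := ht
  have key : ∀ (B : Option NT) (α : List (Symbol T NT)),
      P (B.toList.map nonterminal ++ [terminal t] ++ α) → t = firstLetter a b A := by
    rintro (_ | B) α h <;> simp [P] at h
    exact h
  exact key B α (Derives.invariant (G := grammar a b c d e) hP h (.inl rfl))

/-- Only `Y → bY` ends in a nonterminal. So a string derived from `A` is `A` itself, ends in a
terminal of `lastLetters`, or, for `A = Y`, ends in `bY`; rewriting preserves this trichotomy. -/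
lemma rightTerminals_subset (A : NT) {t : T}
    (ht : t ∈ (grammar a b c d e).rightTerminals A) : t ∈ lastLetters b c d e A := by
  let P (s : List (Symbol T NT)) : Prop :=
    s = [nonterminal A] ∨ (∃ s', ∃ t ∈ lastLetters b c d e A, s = s' ++ [terminal t]) ∨
      (A = Y ∧ ∃ s', s = s' ++ [terminal b] ++ [nonterminal Y])
  have hP : ∀ r ∈ rules a b c d e, ∀ p q, P (p ++ [nonterminal r.input] ++ q) →
      P (p ++ r.output ++ q) := by
    intro r hr p q h
    right
    rcases List.eq_nil_or_concat' q with rfl | ⟨q, z, rfl⟩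
    · rw [List.append_nil] at h ⊢
      obtain rfl : r.input = A := by
        rcases h with h | ⟨s', t, -, h⟩ | ⟨rfl, s', h⟩
        · cases p <;> simp_all
        · exact absurd (List.append_inj' h rfl).2 (by simp)
        · simpa using (List.append_inj' h rfl).2
      rcases output_eq_append a b c d e hr with ⟨s, t, ht, hs⟩ | ⟨hY, s, hs⟩
      · exact .inl ⟨p ++ s, t, ht, by simp [hs]⟩
      · exact .inr ⟨hY, p ++ s, by simp [hs]⟩
    · rw [← List.append_assoc] at h ⊢
      rcases h with h | ⟨s', t, ht, h⟩ | ⟨hY, s', h⟩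
      · have := congrArg List.length h
        simp at this
        omega
      · exact .inl ⟨_, t, ht, by rw [(List.append_inj' h rfl).2]⟩
      · obtain ⟨h, hz⟩ := List.append_inj' h rfl
        rw [hz]
        -- With nothing but the final `Y` to its right, the rewritten nonterminal would stand in the
        -- place of the terminal `b`.
        rcases List.eq_nil_or_concat' q with rfl | ⟨q, y, rfl⟩
        · rw [List.append_nil] at h
          exact absurd (List.append_inj' h rfl).2 (by simp)
        · rw [← List.append_assoc] at h ⊢
          rw [(List.append_inj' h rfl).2]
          exact .inr ⟨hY, _, rfl⟩
  obtain ⟨B, α, h⟩ := ht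
  have key : ∀ (B : Option NT) (α : List (Symbol T NT)),
      P (α ++ [terminal t] ++ B.toList.map nonterminal) → t ∈ lastLetters b c d e A := by
    rintro (_ | B) α (h | ⟨s', t', ht', h⟩ | ⟨rfl, s', h⟩)
    · cases α <;> simp at h
    · simp only [Option.toList_none, List.map_nil, List.append_nil] at h
      have := (List.append_inj' h rfl).2
      simp_all
    · simp only [Option.toList_none, List.map_nil, List.append_nil] at h
      exact absurd (List.append_inj' h rfl).2 (by simp)
    · have := congrArg List.length h
      simp at this
    · exact absurd (List.append_inj' h rfl).2 (by simp)
    · have := (List.append_inj' (List.append_inj' h rfl).1 rfl).2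
      simp at this
      exact .inl this
  exact key B α (Derives.invariant (G := grammar a b c d e) hP h (.inl rfl))

/-- An upper bound of the precedence relations. -/
def precBound : OPRel → T → T → Prop
  | .doteq, x, y => (x = a ∧ y = d) ∨ (x = b ∧ y = c) ∨ (x = b ∧ y = e)
  | .gtrdot, x, y => (y = d ∧ (x = d ∨ x = c ∨ x = b ∨ x = e)) ∨ (x = c ∧ y = c)
  | .lessdot, x, y => (x = a ∧ (y = a ∨ y = b)) ∨ (x = b ∧ y = b)

lemma precBound_of_prec {ρ : OPRel} {x y : T} (h : (grammar a b c d e).Prec ρ x y) :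
    precBound a b c d e ρ x y := by
  cases ρ
  · have key : ∀ r ∈ rules a b c d e, ∀ (α β : List (Symbol T NT)) (B : Option NT),
        r.output = α ++ [terminal x] ++ B.toList.map nonterminal ++ [terminal y] ++ β →
        precBound a b c d e .doteq x y := by
      intro r hr α β B h
      rcases mem_rules.1 hr with rfl | rfl | rfl | rfl | rfl | rfl | rfl <;>
        rcases α with _ | ⟨_, _ | ⟨_, _ | ⟨_, _⟩⟩⟩ <;> cases B <;>
          simp at h <;> simp [precBound, h]
    obtain ⟨r, hr, α, β, B, h⟩ := h
    exact key r hr α β B h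
  · have key : ∀ r ∈ rules a b c d e, ∀ (α β : List (Symbol T NT)) (D : NT),
        r.output = α ++ [nonterminal D, terminal y] ++ β → x ∈ lastLetters b c d e D →
        precBound a b c d e .gtrdot x y := by
      intro r hr α β D h hx
      rcases mem_rules.1 hr with rfl | rfl | rfl | rfl | rfl | rfl | rfl <;>
        rcases α with _ | ⟨_, _ | ⟨_, _ | ⟨_, _⟩⟩⟩ <;> simp at h <;>
          (obtain ⟨_, rfl, rfl, _⟩ := h; simp [lastLetters] at hx; simp only [precBound]; grind)
    obtain ⟨r, hr, α, β, D, h, hx⟩ := h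
    exact key r hr α β D h (rightTerminals_subset a b c d e D hx)
  · have key : ∀ r ∈ rules a b c d e, ∀ (α β : List (Symbol T NT)) (D : NT),
        r.output = α ++ [terminal x, nonterminal D] ++ β → y = firstLetter a b D →
        precBound a b c d e .lessdot x y := by
      intro r hr α β D h hy
      rcases mem_rules.1 hr with rfl | rfl | rfl | rfl | rfl | rfl | rfl <;>
        rcases α with _ | ⟨_, _ | ⟨_, _ | ⟨_, _⟩⟩⟩ <;> simp at h <;>
          (obtain ⟨rfl, rfl, _⟩ := h; simp [precBound, hy, firstLetter])
    obtain ⟨r, hr, α, β, D, h, hy⟩ := h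
    exact key r hr α β D h (leftTerminals_subset a b c d e D hy)

/-- For distinct letters the three relations of `precBound` are pairwise disjoint. The right-linear
rule `Y → bY` adds `b ⋗ d`, which is harmless as `b` and `d` are not related otherwise. -/
theorem mem_FG (h : [a, b, c, d, e].Nodup) : witness₁ a b c d e ∈ FG T := by
  refine ⟨grammar a b c d e, ⟨isOperator_grammar a b c d e, fun x y ρ hρ σ hσ => ?_⟩,
    language_grammar a b c d e⟩
  have h₁ := precBound_of_prec a b c d e hρ
  have h₂ := precBound_of_prec a b c d e hσ
  simp at h
  cases ρ <;> cases σ <;> simp only [precBound] at h₁ h₂ <;> grind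

end Witness₁

/-! ### Runs of pushdown automata, and automata given by transition functions -/

namespace PDA

variable {T : Type} {A : PDA T}

lemma Path.append {u v : List (Option T)} {x y z : A.Config} (h : A.Path u x y)
    (h' : A.Path v y z) : A.Path (u ++ v) x z := by
  induction h with
  | nil => exact h'
  | cons hs _ ih => exact .cons hs (ih h')

lemma Path.exists_of_append {u v : List (Option T)} {x z : A.Config}
    (h : A.Path (u ++ v) x z) : ∃ y, A.Path u x y ∧ A.Path v y z := by
  induction u generalizing x with
  | nil => exact ⟨x, .nil x, h⟩
  | cons l u ih =>
    cases h with
    | cons hs h =>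
      obtain ⟨y, h₁, h₂⟩ := ih h
      exact ⟨y, .cons hs h₁, h₂⟩

lemma Reaches.refl (x : A.Config) : A.Reaches [] x x := ⟨[], .nil x, rfl⟩

lemma Reaches.append {u v : List T} {x y z : A.Config} (h : A.Reaches u x y)
    (h' : A.Reaches v y z) : A.Reaches (u ++ v) x z := by
  obtain ⟨u, hu, rfl⟩ := h
  obtain ⟨v, hv, rfl⟩ := h'
  exact ⟨u ++ v, hu.append hv, List.reduceOption_append u v⟩

lemma Step.reaches {l : Option T} {x y : A.Config} (h : A.Step l x y) :
    A.Reaches l.toList x y :=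
  ⟨[l], .cons h (.nil y), by cases l <;> rfl⟩

/-- A relation between the word read so far and the configuration that is preserved by all steps
holds after every run. -/
lemma Reaches.invariant {P : List T → A.Config → Prop}
    (hP : ∀ w l x y, P w x → A.Step l x y → P (w ++ l.toList) y)
    {u w : List T} {x y : A.Config} (h : A.Reaches w x y) (hx : P u x) : P (u ++ w) y := by
  obtain ⟨v, hv, rfl⟩ := h
  induction hv generalizing u with
  | nil => simpa using hx
  | @cons l v x y z hs _ ih =>
    have := ih (hP u l x y hx hs)
    cases l <;> simpa using this

lemma Deterministic.step_unique (hA : A.Deterministic) {l : Option T} {x y z : A.Config}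
    (hy : A.Step l x y) (hz : A.Step l x z) : y = z := by
  cases hy with
  | @top p q X l α γ h =>
    cases hz with
    | @top _ q' _ _ α' _ h' =>
      have : (q, α) = (q', α') := hA.1 _ _ _ h h'
      simp_all
  | @bottom p q l α h =>
    cases hz with
    | @bottom _ q' _ α' h' => exact hA.1 _ _ _ h h'

lemma Deterministic.path_unique (hA : A.Deterministic) {v : List (Option T)} {x y z : A.Config}
    (hy : A.Path v x y) (hz : A.Path v x z) : y = z := by
  induction hy with
  | nil => cases hz; rfl
  | cons hs _ ih =>
    cases hz with
    | cons hs' h => exact ih (hA.step_unique hs hs' ▸ h)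

section OfFun

variable {Q Γ : Type} [Finite T] [Finite Q] [Finite Γ]

/-- The pushdown automaton whose rules form the graph of a partial function. -/
def ofFun (δ : Q → Option Γ → Option T → Option (Q × List Γ)) (q₀ : Q) (F : Set Q) : PDA T where
  State := Q
  Stack := Γ
  finite_state := inferInstance
  finite_stack := inferInstance
  rules := {r | δ r.1 r.2.1 r.2.2.1 = some r.2.2.2}
  finite_rules := by
    -- A rule is determined by its state, top symbol and label, of which there are finitely many.
    refine Set.Finite.of_finite_image (f := fun r => (r.1, r.2.1, r.2.2.1)) (Set.toFinite _) ?_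
    rintro ⟨p, X, l, x⟩ h ⟨p', X', l', x'⟩ h' heq
    simp only [Prod.mk.injEq] at heq
    obtain ⟨rfl, rfl, rfl⟩ := heq
    simp_all
  start := q₀
  final := F

variable {δ : Q → Option Γ → Option T → Option (Q × List Γ)} {q₀ : Q} {F : Set Q}

/-- Since `[].head? = none` and `[].tail = []`, one formula covers ordinary top symbols and the
bottom symbol. -/
lemma step_ofFun_iff {l : Option T} {p q : Q} {γ γ' : List Γ} :
    (ofFun δ q₀ F).Step l (p, γ) (q, γ') ↔
      ∃ α, δ p γ.head? l = some (q, α) ∧ γ' = α ++ γ.tail := by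
  constructor
  · intro h
    cases h with
    | @top _ _ X _ α γ h => exact ⟨α, h, rfl⟩
    | bottom h => exact ⟨_, h, (List.append_nil _).symm⟩
  · rintro ⟨α, h, rfl⟩
    cases γ with
    | nil => exact (List.append_nil α).symm ▸ Step.bottom (A := ofFun δ q₀ F) h
    | cons X γ => exact Step.top (A := ofFun δ q₀ F) γ h

lemma reaches_ofFun {l : Option T} {p q : Q} {γ γ' : List Γ} {w : List T} (α : List Γ)
    (h : δ p γ.head? l = some (q, α)) (hγ : α ++ γ.tail = γ') (hw : l.toList = w) :
    (ofFun δ q₀ F).Reaches w (p, γ) (q, γ') :=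
  hw ▸ (step_ofFun_iff.2 ⟨α, h, hγ.symm⟩).reaches

lemma deterministic_ofFun
    (h : ∀ p X l, (δ p X none).isSome → (δ p X l).isSome → l = none) :
    (ofFun δ q₀ F).Deterministic := by
  refine ⟨fun p X l x hx y hy => ?_, fun p X q α l r β h₁ h₂ => h p X l ?_ ?_⟩
  · exact Option.some_injective _ (hx.symm.trans hy)
  · exact Option.isSome_iff_exists.2 ⟨_, h₁⟩
  · exact Option.isSome_iff_exists.2 ⟨_, h₂⟩

lemma reaches_ofFun_invariant {P : List T → Q → List Γ → Prop} (h₀ : P [] q₀ [])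
    (hP : ∀ w l p q γ α, P w p γ → δ p γ.head? l = some (q, α) →
      P (w ++ l.toList) q (α ++ γ.tail))
    {w : List T} {p : Q} {γ : List Γ}
    (h : (ofFun δ q₀ F).Reaches w (ofFun δ q₀ F).init (p, γ)) : P w p γ := by
  refine h.invariant (P := fun w x => P w x.1 x.2) (u := []) ?_ h₀
  rintro w l ⟨p, γ⟩ ⟨q, γ'⟩ hw h
  obtain ⟨α, hα, rfl⟩ := step_ofFun_iff.1 h
  exact hP w l p q γ α hw hα

lemma complete_ofFun (h : ∀ p X t, (δ p X (some t)).isSome) : (ofFun δ q₀ F).Complete := by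
  have key : ∀ (w : List T) (p : Q) (γ : List Γ), ∃ y, (ofFun δ q₀ F).Reaches w (p, γ) y := by
    intro w
    induction w with
    | nil => exact fun p γ => ⟨(p, γ), .refl _⟩
    | cons t w ih =>
      intro p γ
      obtain ⟨⟨q, α⟩, hq⟩ := Option.isSome_iff_exists.1 (h p γ.head? t)
      obtain ⟨y, hy⟩ := ih q (α ++ γ.tail)
      exact ⟨y, (reaches_ofFun α hq rfl rfl).append hy⟩
  exact fun w => key w _ _

end OfFun

end PDA

/-! ### A height-deterministic realtime automaton for `aⁿcaⁿ` -/

namespace Witness₂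

inductive State
  | push | pop | accept | sink

instance : Finite State := .of_surjective ![State.push, .pop, .accept, .sink] (by
  rintro (_ | _ | _ | _)
  exacts [⟨0, rfl⟩, ⟨1, rfl⟩, ⟨2, rfl⟩, ⟨3, rfl⟩])

inductive Stack
  | Z | A

instance : Finite Stack := .of_surjective ![Stack.Z, .A] (by
  rintro (_ | _)
  exacts [⟨0, rfl⟩, ⟨1, rfl⟩])

open State Stack

variable {T : Type} (a c : T)

open Classical in
/-- The transition function of a realtime automaton for `aⁿ c aⁿ`: it pushes one symbol for each
`a` before `c`, with a mark `Z` on the first one, and pops one symbol for each `a` after `c`. -/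
noncomputable def δ : State → Option Stack → Option T → Option (State × List Stack)
  | _, _, none => none
  | push, none, some t =>
    if t = a then some (push, [Z]) else if t = c then some (accept, []) else some (sink, [])
  | push, some X, some t =>
    if t = a then some (push, [A, X]) else if t = c then some (pop, [X]) else some (sink, [X])
  | pop, some A, some t => if t = a then some (pop, []) else some (sink, [A])
  -- Acceptance is by state alone, and no empty move can test for the bottom afterwards; the mark
  -- `Z` announces the last pop.
  | pop, some Z, some t => if t = a then some (accept, []) else some (sink, [Z])
  | pop, none, some _ => some (sink, [])
  | accept, X, some _ => some (sink, X.toList)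
  | sink, X, some _ => some (sink, X.toList)

variable [Finite T]

noncomputable def automaton : PDA T := PDA.ofFun (δ a c) push {accept}

lemma realtime : (automaton a c).Realtime := by
  rintro p X l q α h rfl
  change δ a c p X none = _ at h
  simp [δ] at h

lemma deterministic : (automaton a c).Deterministic :=
  PDA.deterministic_ofFun fun p X l h => by simp [δ] at h

lemma normalForm {p q : State} {X : Option Stack} {l : Option T} {α : List Stack}
    (h : δ a c p X l = some (q, α)) : (automaton a c).NormalForm X α := by
  rcases l with _ | t
  · simp [δ] at h
  · rcases p with _ | _ | _ | _ <;> rcases X with _ | _ | _ <;> simp only [δ] at h <;>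
      (try split_ifs at h) <;> cases h <;>
      first
      | exact .inl rfl
      | exact .inr (.inl rfl)
      | exact .inr ⟨_, rfl⟩
      | exact .inr (.inr ⟨_, rfl⟩)

/-- In a deterministic automaton the exact label sequence determines the path, hence the height.
Completeness comes from the sink. -/
lemma heightDeterministic : (automaton a c).HeightDeterministic where
  normalized :=
    { complete := PDA.complete_ofFun fun p X t => by
        rcases p with _ | _ | _ | _ <;> rcases X with _ | _ | _ <;> simp only [δ] <;>
          (try split_ifs) <;> rfl
      uniform := fun p => .inl fun X l q α h => realtime a c p X l q α h
      form := fun p X l q α h => normalForm a c h }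
  heights_subsingleton := by
    rintro v _ ⟨q, γ, h, rfl⟩ _ ⟨q', γ', h', rfl⟩
    have := (deterministic a c).path_unique h h'
    simp_all

/-- The stack after reading `aⁿ`. -/
def stack : ℕ → List Stack
  | 0 => []
  | n + 1 => List.replicate n A ++ [Z]

/-- The words that lead to a configuration. -/
def Inv (w : List T) : State → List Stack → Prop
  | push, γ => ∃ n, w = List.replicate n a ∧ γ = stack n
  | pop, γ => ∃ n k, w = List.replicate (n + 1 + k) a ++ [c] ++ List.replicate k a ∧
      γ = stack (n + 1)
  | accept, γ => w ∈ witness₂ a c ∧ γ = []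
  | sink, _ => True

lemma language_automaton (hac : a ≠ c) : (automaton a c).language = witness₂ a c := by
  ext w
  constructor
  · rintro ⟨p, rfl, γ, h⟩
    refine (PDA.reaches_ofFun_invariant (P := Inv a c) (q₀ := push) ⟨0, rfl, rfl⟩ ?_ h).1
    · intro w l p q γ α hw h
      rcases l with _ | t
      · simp [δ] at h
      rcases p with _ | _ | _ | _
      · obtain ⟨n, rfl, rfl⟩ := hw
        rcases n with _ | _ | n <;> simp [stack, δ, List.replicate_succ] at h <;> split_ifs at h <;>
          simp at h <;> obtain ⟨rfl, rfl⟩ := h <;> subst_vars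
        · exact ⟨1, rfl, rfl⟩
        · exact ⟨⟨0, rfl⟩, rfl⟩
        · trivial
        · exact ⟨2, rfl, rfl⟩
        · exact ⟨0, 0, rfl, rfl⟩
        · trivial
        · exact ⟨n + 3, by simp [List.replicate_succ' (n := n + 2)], rfl⟩
        · exact ⟨n + 1, 0, by simp, rfl⟩
        · trivial
      · obtain ⟨n, k, rfl, rfl⟩ := hw
        rcases n with _ | n <;> simp [stack, δ, List.replicate_succ] at h <;> split_ifs at h <;>
          simp at h <;> obtain ⟨rfl, rfl⟩ := h <;> subst_vars
        · refine ⟨⟨k + 1, ?_⟩, rfl⟩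
          simp [List.replicate_succ' (n := k), show 0 + 1 + k = k + 1 by omega]
        · trivial
        · refine ⟨n, k + 1, ?_, rfl⟩
          simp [List.replicate_succ' (n := k), show n + 1 + (k + 1) = n + 1 + 1 + k by omega]
        · trivial
      · simp [δ] at h
        rw [← h.1]
        trivial
      · simp [δ] at h
        rw [← h.1]
        trivial
  · rintro ⟨n, rfl⟩
    have hpush : ∀ n, (automaton a c).Reaches (List.replicate n a) (push, []) (push, stack n) := by
      intro n
      induction n with
      | zero => exact .refl _
      | succ n ih =>
        rw [List.replicate_succ']
        refine ih.append ?_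
        rcases n with _ | _ | n
        · exact PDA.reaches_ofFun (l := some a) [Z] (by simp [δ, stack]) rfl rfl
        · exact PDA.reaches_ofFun (l := some a) [A, Z] (by simp [δ, stack]) rfl rfl
        · exact PDA.reaches_ofFun (l := some a) [A, A]
            (by simp [δ, stack, List.replicate_succ]) rfl rfl
    have hpop : ∀ n, (automaton a c).Reaches (List.replicate (n + 1) a) (pop, stack (n + 1))
        (accept, []) := by
      intro n
      induction n with
      | zero => exact PDA.reaches_ofFun (l := some a) [] (by simp [δ, stack]) rfl rfl
      | succ n ih =>
        rw [List.replicate_succ]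
        exact PDA.Reaches.append (u := [a]) (PDA.reaches_ofFun (l := some a) []
          (by simp [δ, stack, List.replicate_succ]) rfl rfl) ih
    refine ⟨accept, rfl, [], ?_⟩
    rw [List.append_assoc]
    refine (hpush n).append ?_
    rcases n with _ | _ | n
    · exact PDA.reaches_ofFun (l := some c) [] (by simp [δ, stack, hac.symm]) rfl rfl
    · exact PDA.Reaches.append (PDA.reaches_ofFun (l := some c) [Z]
        (by simp [δ, stack, hac.symm]) rfl rfl) (hpop 0)
    · exact PDA.Reaches.append (PDA.reaches_ofFun (l := some c) [A]
        (by simp [δ, stack, List.replicate_succ, hac.symm]) rfl rfl) (hpop (n + 1))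

theorem mem_HRDPDA (hac : a ≠ c) : witness₂ a c ∈ HRDPDA T :=
  ⟨automaton a c, heightDeterministic a c, realtime a c, deterministic a c,
    language_automaton a c hac⟩

end Witness₂

/-! ### A deterministic automaton for `witness₁` -/

namespace Witness₁

inductive State
  | start | as | bs | cs | es | accept

instance : Finite State := .of_surjective ![State.start, .as, .bs, .cs, .es, .accept] (by
  rintro (_ | _ | _ | _ | _ | _)
  exacts [⟨0, rfl⟩, ⟨1, rfl⟩, ⟨2, rfl⟩, ⟨3, rfl⟩, ⟨4, rfl⟩, ⟨5, rfl⟩])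

inductive Stack
  | Z | A | B

instance : Finite Stack := .of_surjective ![Stack.Z, .A, .B] (by
  rintro (_ | _ | _)
  exacts [⟨0, rfl⟩, ⟨1, rfl⟩, ⟨2, rfl⟩])

open State Stack

variable {T : Type} (a b c d e : T)

open Classical in
/-- The transition function of a deterministic automaton for `witness₁`: it pushes one symbol for
each `a` and `b`, with a mark `Z` on the first one. The symbols `B` are popped by the letters `c`,
or without input after the letter `e`; the other symbols are popped by the letters `d`. -/
noncomputable def δ : State → Option Stack → Option T → Option (State × List Stack)
  | start, none, some t => if t = a then some (as, [Z]) else none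
  | as, some X, some t =>
    if t = a then some (as, [A, X]) else if t = b then some (bs, [B, X]) else none
  | bs, some B, some t =>
    if t = b then some (bs, [B, B]) else if t = c then some (cs, [])
    else if t = e then some (es, [B]) else none
  | cs, some B, some t => if t = c then some (cs, []) else none
  | cs, some A, some t => if t = d then some (cs, []) else none
  | cs, some Z, some t => if t = d then some (accept, []) else none
  | es, some B, none => some (es, [])
  | es, some A, some t => if t = d then some (es, []) else none
  | es, some Z, some t => if t = d then some (accept, []) else none
  | _, _, _ => none

/-- The stack after reading `aⁱ⁺¹ bʲ`. -/
def stack (j i : ℕ) : List Stack := List.replicate j B ++ (List.replicate i A ++ [Z])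

@[simp] lemma stack_succ (j i : ℕ) : stack (j + 1) i = B :: stack j i := rfl

@[simp] lemma stack_zero_succ (i : ℕ) : stack 0 (i + 1) = A :: stack 0 i := rfl

@[simp] lemma stack_zero_zero : stack 0 0 = [Z] := rfl

/-- The words that lead to a configuration. -/
def Inv (w : List T) : State → List Stack → Prop
  | start, γ => w = [] ∧ γ = []
  | as, γ => ∃ i, w = List.replicate (i + 1) a ∧ γ = stack 0 i
  | bs, γ => ∃ i j, w = List.replicate (i + 1) a ++ List.replicate (j + 1) b ∧
      γ = stack (j + 1) i
  | cs, γ => ∃ i l j k, w = List.replicate (i + l + 1) a ++ List.replicate (j + k + 1) b ++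
      List.replicate (k + 1) c ++ List.replicate l d ∧ γ = stack j i ∧ (j = 0 ∨ l = 0)
  | es, γ => ∃ i l j n, w = List.replicate (i + l + 1) a ++ List.replicate (n + 1) b ++
      [e] ++ List.replicate l d ∧ γ = stack j i ∧ (j = 0 ∨ l = 0)
  | accept, γ => w ∈ witness₁ a b c d e ∧ γ = []

/-- In the states `cs` and `es`, `i` and `j` count the symbols `A` and `B` still on the stack and
`l` the letters `d` read. The clause `j = 0 ∨ l = 0` says that no `d` is read before the last `B` is
gone. -/
lemma inv_step (w : List T) (l : Option T) (p q : State) (γ α : List Stack)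
    (hw : Inv a b c d e w p γ) (h : δ a b c d e p γ.head? l = some (q, α)) :
    Inv a b c d e (w ++ l.toList) q (α ++ γ.tail) := by
  rcases p with _ | _ | _ | _ | _ | _
  · obtain ⟨rfl, rfl⟩ := hw
    rcases l with _ | t <;> simp [δ] at h
    obtain ⟨rfl, rfl, rfl⟩ := h
    exact ⟨0, rfl, rfl⟩
  · obtain ⟨i, rfl, rfl⟩ := hw
    rcases l with _ | t
    · rcases i with _ | i <;> simp [δ] at h
    · have h' : ∃ X, (stack 0 i).head? = some X ∧ X :: (stack 0 i).tail = stack 0 i := by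
        rcases i with _ | i <;> exact ⟨_, rfl, rfl⟩
      obtain ⟨X, hX, hX'⟩ := h'
      rw [hX] at h
      simp only [δ] at h
      split_ifs at h <;> simp at h <;> obtain ⟨rfl, rfl⟩ := h <;> subst_vars
      · exact ⟨i + 1, by simp [List.replicate_succ' (n := i + 1)], by simp [hX']⟩
      · exact ⟨i, 0, by simp, by simp [hX']⟩
  · obtain ⟨i, j, rfl, rfl⟩ := hw
    rcases l with _ | t
    · simp [δ] at h
    · simp only [stack_succ, List.head?_cons, δ] at h
      split_ifs at h <;> simp at h <;> obtain ⟨rfl, rfl⟩ := h <;> subst_vars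
      · exact ⟨i, j + 1, by simp [List.replicate_succ' (n := j + 1)], by simp⟩
      · exact ⟨i, 0, j, 0, by simp, by simp, .inr rfl⟩
      · exact ⟨i, 0, j + 1, j, by simp, by simp, .inr rfl⟩
  · obtain ⟨i, l', j, k, rfl, rfl, hjl⟩ := hw
    rcases j with _ | j
    · rcases i with _ | i
      · rcases l with _ | t <;> simp [δ] at h
        obtain ⟨rfl, rfl, rfl⟩ := h
        refine ⟨⟨l' + 1, k + 1, by omega, by omega, .inl ?_⟩, by simp⟩
        simp [List.replicate_succ' (n := l') (a := t)]
      · rcases l with _ | t <;> simp [δ] at h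
        obtain ⟨rfl, rfl, rfl⟩ := h
        refine ⟨i, l' + 1, 0, k, ?_, by simp, .inl rfl⟩
        simp [List.replicate_succ' (n := l') (a := t), show i + 1 + l' = i + (l' + 1) by omega]
    · obtain rfl : l' = 0 := by omega
      rcases l with _ | t <;> simp [δ] at h
      obtain ⟨rfl, rfl, rfl⟩ := h
      refine ⟨i, 0, j, k + 1, ?_, by simp, .inr rfl⟩
      simp [List.replicate_succ' (n := k + 1) (a := t), show j + 1 + k = j + (k + 1) by omega]
  · obtain ⟨i, l', j, n, rfl, rfl, hjl⟩ := hw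
    rcases j with _ | j
    · rcases i with _ | i
      · rcases l with _ | t <;> simp [δ] at h
        obtain ⟨rfl, rfl, rfl⟩ := h
        refine ⟨⟨l' + 1, n + 1, by omega, by omega, .inr ?_⟩, by simp⟩
        simp [List.replicate_succ' (n := l') (a := t)]
      · rcases l with _ | t <;> simp [δ] at h
        obtain ⟨rfl, rfl, rfl⟩ := h
        refine ⟨i, l' + 1, 0, n, ?_, by simp, .inl rfl⟩
        simp [List.replicate_succ' (n := l') (a := t), show i + 1 + l' = i + (l' + 1) by omega]
    · obtain rfl : l' = 0 := by omega
      rcases l with _ | t <;> simp [δ] at h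
      obtain ⟨rfl, rfl⟩ := h
      exact ⟨i, 0, j, n, by simp, by simp, .inr rfl⟩
  · simp [δ] at h

variable [Finite T]

noncomputable def automaton : PDA T := PDA.ofFun (δ a b c d e) start {accept}

lemma deterministic : (automaton a b c d e).Deterministic :=
  PDA.deterministic_ofFun fun p X l h h' => by
    rcases p with _ | _ | _ | _ | _ | _ <;> rcases X with _ | _ | _ | _ <;> simp [δ] at h
    -- Only state `es` with top `B` has an empty move, and it has no other.
    rcases l with _ | t
    · rfl
    · simp [δ] at h'

lemma language_automaton (h : [a, b, c, d, e].Nodup) :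
    (automaton a b c d e).language = witness₁ a b c d e := by
  ext w
  constructor
  · rintro ⟨p, rfl, γ, h⟩
    exact (PDA.reaches_ofFun_invariant (P := Inv a b c d e) (q₀ := start) ⟨rfl, rfl⟩
      (inv_step a b c d e) h).1
  · simp only [List.nodup_cons, List.mem_cons, List.not_mem_nil, or_false, not_or] at h
    obtain ⟨⟨hab, hac, had, hae⟩, ⟨hbc, hbd, hbe⟩, ⟨hcd, hce⟩, hde, -⟩ := h
    have has : ∀ i, (automaton a b c d e).Reaches (List.replicate (i + 1) a)
        (start, []) (as, stack 0 i) := by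
      intro i
      induction i with
      | zero => exact PDA.reaches_ofFun (l := some a) (γ := []) [Z] (if_pos rfl) rfl rfl
      | succ i ih =>
        rw [List.replicate_succ']
        refine ih.append ?_
        rcases i with _ | i
        · exact PDA.reaches_ofFun (l := some a) [A, Z] (by simp [δ]) rfl rfl
        · exact PDA.reaches_ofFun (l := some a) [A, A] (by simp [δ]) rfl rfl
    have hbs : ∀ i j, (automaton a b c d e).Reaches (List.replicate (j + 1) b)
        (as, stack 0 i) (bs, stack (j + 1) i) := by
      intro i j
      induction j with
      | zero =>
        rcases i with _ | i
        · exact PDA.reaches_ofFun (l := some b) [B, Z] (by simp [δ, Ne.symm hab]) rfl rfl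
        · exact PDA.reaches_ofFun (l := some b) [B, A] (by simp [δ, Ne.symm hab]) rfl rfl
      | succ j ih =>
        rw [List.replicate_succ']
        exact ih.append (PDA.reaches_ofFun (l := some b) [B, B] (by simp [δ]) rfl rfl)
    have hcs : ∀ i j, (automaton a b c d e).Reaches (List.replicate j c)
        (cs, stack j i) (cs, stack 0 i) := by
      intro i j
      induction j with
      | zero => exact .refl _
      | succ j ih =>
        exact PDA.Reaches.append (u := [c])
          (PDA.reaches_ofFun (l := some c) [] (by simp [δ]) rfl rfl) ih
    have hcs' : ∀ i, (automaton a b c d e).Reaches (List.replicate (i + 1) d)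
        (cs, stack 0 i) (accept, []) := by
      intro i
      induction i with
      | zero => exact PDA.reaches_ofFun (l := some d) [] (by simp [δ]) rfl rfl
      | succ i ih =>
        exact PDA.Reaches.append (u := [d])
          (PDA.reaches_ofFun (l := some d) [] (by simp [δ]) rfl rfl) ih
    have hes : ∀ i j, (automaton a b c d e).Reaches [] (es, stack j i) (es, stack 0 i) := by
      intro i j
      induction j with
      | zero => exact .refl _
      | succ j ih =>
        exact PDA.Reaches.append (u := [])
          (PDA.reaches_ofFun (l := none) [] (by simp [δ]) rfl rfl) ih
    have hes' : ∀ i, (automaton a b c d e).Reaches (List.replicate (i + 1) d)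
        (es, stack 0 i) (accept, []) := by
      intro i
      induction i with
      | zero => exact PDA.reaches_ofFun (l := some d) [] (by simp [δ]) rfl rfl
      | succ i ih =>
        exact PDA.Reaches.append (u := [d])
          (PDA.reaches_ofFun (l := some d) [] (by simp [δ]) rfl rfl) ih
    rintro ⟨m, n, hm, hn, h⟩
    obtain ⟨i, rfl⟩ := Nat.exists_eq_add_of_le' hm
    obtain ⟨j, rfl⟩ := Nat.exists_eq_add_of_le' hn
    refine ⟨accept, rfl, [], ?_⟩
    rcases h with rfl | rfl
    · refine (((has i).append (hbs i j)).append ?_).append (hcs' i)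
      exact PDA.Reaches.append (u := [c])
        (PDA.reaches_ofFun (l := some c) [] (by simp [δ, Ne.symm hbc]) rfl rfl) (hcs i j)
    · refine (((has i).append (hbs i j)).append ?_).append (hes' i)
      exact PDA.Reaches.append (u := [e]) (v := [])
        (PDA.reaches_ofFun (l := some e) [B]
          (by simp [δ, Ne.symm hbe, Ne.symm hce]) rfl rfl) (hes i (j + 1))

theorem mem_DPDA (h : [a, b, c, d, e].Nodup) : witness₁ a b c d e ∈ DPDA T :=
  ⟨automaton a b c d e, deterministic a b c d e, language_automaton a b c d e h⟩

end Witness₁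

/-! ### Realtime runs and stack heights -/

namespace PDA

variable {T : Type} {A : PDA T}

lemma Reaches.exists_of_append {u v : List T} {x z : A.Config} (h : A.Reaches (u ++ v) x z) :
    ∃ y, A.Reaches u x y ∧ A.Reaches v y z := by
  obtain ⟨w, hw, h⟩ := h
  obtain ⟨u', v', rfl, rfl, rfl⟩ := (List.reduceOption_eq_append_iff _ _ _).1 h
  obtain ⟨y, h₁, h₂⟩ := hw.exists_of_append
  exact ⟨y, ⟨u', h₁, rfl⟩, ⟨v', h₂, rfl⟩⟩

lemma Realtime.path_of_reaches (hA : A.Realtime) {w : List T} {x y : A.Config}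
    (h : A.Reaches w x y) : A.Path (w.map some) x y := by
  obtain ⟨v, hv, rfl⟩ := h
  induction hv with
  | nil x => exact .nil x
  | @cons l v x y z hs _ ih =>
    cases l with
    | none => cases hs with
      | top _ h => exact absurd rfl (hA _ _ _ _ _ h)
      | bottom h => exact absurd rfl (hA _ _ _ _ _ h)
    | some t => exact .cons hs ih

lemma Realtime.step_of_reaches (hA : A.Realtime) {t : T} {x y : A.Config}
    (h : A.Reaches [t] x y) : A.Step (some t) x y := by
  cases hA.path_of_reaches h with
  | cons hs h => cases h; exact hs

lemma Realtime.reaches_unique (hA : A.Realtime) (hd : A.Deterministic) {w : List T}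
    {x y z : A.Config} (hy : A.Reaches w x y) (hz : A.Reaches w x z) : y = z :=
  hd.path_unique (hA.path_of_reaches hy) (hA.path_of_reaches hz)

/-- Reading the word `w` from the configuration `x` leads to a final state. -/
def AcceptsFrom (A : PDA T) (x : A.Config) (w : List T) : Prop :=
  ∃ p ∈ A.final, ∃ γ, A.Reaches w x (p, γ)

/-- The configuration after `u` is unique, so it alone decides which continuations of `u` are
accepted. -/
lemma acceptsFrom_iff (hA : A.Realtime) (hd : A.Deterministic) {u v : List T} {x : A.Config}
    (hu : A.Reaches u A.init x) : A.AcceptsFrom x v ↔ u ++ v ∈ A.language := by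
  constructor
  · rintro ⟨p, hp, γ, h⟩
    exact ⟨p, hp, γ, hu.append h⟩
  · rintro ⟨p, hp, γ, h⟩
    obtain ⟨y, h₁, h₂⟩ := h.exists_of_append
    exact ⟨p, hp, γ, hA.reaches_unique hd hu h₁ ▸ h₂⟩

/-- A step from a stack `Y ++ γ` with `Y` nonempty does not depend on `γ`. -/
lemma Step.exists_of_append {l : Option T} {p q : A.State} {Y γ β : List A.Stack} (hY : Y ≠ [])
    (h : A.Step l (p, Y ++ γ) (q, β)) :
    ∃ Y', β = Y' ++ γ ∧ Y.length ≤ Y'.length + 1 ∧ ∀ γ', A.Step l (p, Y ++ γ') (q, Y' ++ γ') := by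
  obtain ⟨X, Y, rfl⟩ := List.exists_cons_of_ne_nil hY
  cases h with
  | @top _ _ _ _ α _ h =>
    refine ⟨α ++ Y, by simp, by simp, fun γ' => ?_⟩
    rw [List.append_assoc]
    exact .top (Y ++ γ') h

/-- A path that is not longer than the upper part `Y` of the stack `Y ++ γ` does not depend
on `γ`. -/
lemma Path.exists_of_length_le {v : List (Option T)} {p q : A.State} {Y γ β : List A.Stack}
    (h : A.Path v (p, Y ++ γ) (q, β)) (hv : v.length ≤ Y.length) (γ' : List A.Stack) :
    ∃ β', A.Path v (p, Y ++ γ') (q, β') := by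
  induction v generalizing p Y with
  | nil => cases h; exact ⟨_, .nil _⟩
  | cons l v ih =>
    cases h with
    | @cons _ _ _ y _ hs h =>
      obtain ⟨p', β'⟩ := y
      have hY : Y ≠ [] := by
        rintro rfl
        simp at hv
      obtain ⟨Y', rfl, hlen, hs'⟩ := hs.exists_of_append hY
      rw [List.length_cons] at hv
      -- A step shortens the upper part by at most one symbol, just as the remaining path gets
      -- shorter by one.
      obtain ⟨β', h'⟩ := ih h (by omega)
      exact ⟨β', .cons (hs' γ') h'⟩

/-- A sequence of pairwise distinct configurations reaches arbitrarily high stacks. -/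
lemma exists_height_ge {x : ℕ → A.Config} (hx : Function.Injective x) (h : ℕ) :
    ∃ N, ∀ n, N ≤ n → h ≤ (x n).2.length := by
  have := A.finite_state
  have := A.finite_stack
  have hfin : {y : A.Config | y.2.length < h}.Finite := by
    have : {y : A.Config | y.2.length < h} = Set.univ ×ˢ {γ : List A.Stack | γ.length < h} := by
      ext; simp
    rw [this]
    exact Set.finite_univ.prod (List.finite_length_lt _ h)
  -- Finitely many configurations are lower than `h`, and an injective sequence visits each at most
  -- once.
  obtain ⟨N, hN⟩ := (hfin.preimage hx.injOn).bddAbove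
  refine ⟨N + 1, fun n hn => ?_⟩
  by_contra hlt
  have : n ≤ N := hN (show (x n).2.length < h by omega)
  omega

/-- A sequence of pairwise distinct configurations has a moment with a nonempty stack after which
the stack never gets lower. -/
lemma exists_min_height {x : ℕ → A.Config} (hx : Function.Injective x) :
    ∃ t, 1 ≤ (x t).2.length ∧ ∀ n, t ≤ n → (x t).2.length ≤ (x n).2.length := by
  obtain ⟨N, hN⟩ := exists_height_ge hx 1
  -- The height is minimized over the tail `n ≥ N`, where the stack is nonempty.
  obtain ⟨t, ht, hmin⟩ := (measure fun n => (x n).2.length).wf.has_min (Set.Ici N) ⟨N, Set.self_mem_Ici⟩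
  exact ⟨t, hN t ht, fun n hn => not_lt.1 (hmin n (le_trans ht hn))⟩

/-- If a sequence of distinct configurations, each reached from the preceding one by reading `b`,
has its lowest stack `X :: γ` in the beginning, then `γ` has no influence on it. -/
lemma exists_upper_run {b : T} {x : ℕ → A.Config} (hA : A.Realtime)
    (hx : ∀ n, A.Reaches [b] (x n) (x (n + 1))) {t : ℕ} {q : A.State} {X : A.Stack}
    {γ : List A.Stack} (ht : x t = (q, X :: γ))
    (hmin : ∀ n, t ≤ n → (x t).2.length ≤ (x n).2.length) (k : ℕ) :
    ∃ p Y, Y ≠ [] ∧ x (t + k) = (p, Y ++ γ) ∧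
      A.Path (List.replicate k (some b)) (q, [X]) (p, Y) := by
  induction k with
  | zero => exact ⟨q, [X], by simp, ht, .nil _⟩
  | succ k ih =>
    obtain ⟨p, Y, hY, hk, hp⟩ := ih
    have hs := hA.step_of_reaches (hx (t + k))
    have hlen := hmin (t + (k + 1)) (by omega)
    rw [ht] at hlen
    change A.Step _ _ (x (t + (k + 1))) at hs
    generalize x (t + (k + 1)) = y at hs hlen ⊢
    obtain ⟨p', β⟩ := y
    rw [hk] at hs
    obtain ⟨Y', rfl, -, hs'⟩ := hs.exists_of_append hY
    -- An empty `Y'` would leave just `γ`, lower than the minimal stack `X :: γ`.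
    refine ⟨p', Y', ?_, rfl, ?_⟩
    · rintro rfl
      simp at hlen
    · rw [List.replicate_succ']
      refine hp.append (.cons ?_ (.nil _))
      simpa using hs' []

end PDA

/-! ### `witness₁` is not realtime deterministic -/

namespace Witness₁

variable {T : Type} {a b c d e : T}

lemma eq_of_mem_left (h : [a, b, c, d, e].Nodup) {m n k l : ℕ} (hk : 1 ≤ k)
    (hw : List.replicate m a ++ List.replicate n b ++ (List.replicate k c ++ List.replicate l d) ∈
      witness₁ a b c d e) : n = k := by
  classical
  simp only [List.nodup_cons, List.mem_cons, List.not_mem_nil, or_false, not_or] at h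
  obtain ⟨m', n', -, -, hw | hw⟩ := hw
  · have hb := congrArg (List.count b) hw
    have hc := congrArg (List.count c) hw
    simp [List.count_replicate, h] at hb hc
    grind
  -- A word of the second kind contains no `c`, against `1 ≤ k`.
  · have hc := congrArg (List.count c) hw
    simp [List.count_replicate, h] at hc
    grind

lemma eq_of_mem_right (h : [a, b, c, d, e].Nodup) {m n l : ℕ}
    (hw : List.replicate m a ++ List.replicate n b ++ ([e] ++ List.replicate l d) ∈
      witness₁ a b c d e) : m = l := by
  classical
  simp only [List.nodup_cons, List.mem_cons, List.not_mem_nil, or_false, not_or] at h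
  obtain ⟨m', n', -, -, hw | hw⟩ := hw
  · have he := congrArg (List.count e) hw
    simp [List.count_replicate, h] at he
  · have ha := congrArg (List.count a) hw
    have hd := congrArg (List.count d) hw
    simp [List.count_replicate, h] at ha hd
    grind

open PDA in
theorem notMem_RDPDA (h : [a, b, c, d, e].Nodup) : witness₁ a b c d e ∉ RDPDA T := by
  rintro ⟨A, hA, hd, hL⟩
  have hstates := A.finite_state
  have hstack := A.finite_stack
  have hexists : ∀ m n, ∃ x, A.Reaches (List.replicate (m + 1) a ++ List.replicate (n + 1) b)
      A.init x := by
    intro m n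
    have : List.replicate (m + 1) a ++ List.replicate (n + 1) b ++
        ([e] ++ List.replicate (m + 1) d) ∈ A.language := by
      rw [hL]
      exact ⟨m + 1, n + 1, by omega, by omega, .inr (by simp)⟩
    obtain ⟨p, -, γ, h⟩ := this
    obtain ⟨x, hx, -⟩ := h.exists_of_append
    exact ⟨x, hx⟩
  choose x hx using hexists
  have hacc : ∀ m n v, A.AcceptsFrom (x m n) v ↔
      List.replicate (m + 1) a ++ List.replicate (n + 1) b ++ v ∈ witness₁ a b c d e :=
    fun m n v => hL ▸ acceptsFrom_iff hA hd (hx m n)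
  have hstep : ∀ m n, A.Reaches [b] (x m n) (x m (n + 1)) := by
    intro m n
    have := hx m (n + 1)
    rw [List.replicate_succ' (a := b), ← List.append_assoc] at this
    obtain ⟨y, h₁, h₂⟩ := this.exists_of_append
    rwa [hA.reaches_unique hd (hx m n) h₁]
  have hinj : ∀ m, Function.Injective (x m) := by
    intro m n n' hnn
    -- The continuation `cⁿ⁺¹dᵐ⁺¹` distinguishes `x m n` from every other `x m n'`.
    have h₁ : A.AcceptsFrom (x m n) (List.replicate (n + 1) c ++ List.replicate (m + 1) d) :=
      (hacc m n _).2 ⟨m + 1, n + 1, by omega, by omega, .inl (by simp)⟩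
    rw [hnn, hacc] at h₁
    have := eq_of_mem_left h (by omega) h₁
    omega
  have hbase : ∀ m, ∃ (t : ℕ) (q : A.State) (X : A.Stack) (γ : List A.Stack),
      x m t = (q, X :: γ) ∧ ∀ n, t ≤ n → (x m t).2.length ≤ (x m n).2.length := by
    intro m
    obtain ⟨t, ht, hmin⟩ := exists_min_height (hinj m)
    obtain ⟨X, γ, hX⟩ := List.exists_cons_of_length_pos ht
    exact ⟨t, (x m t).1, X, γ, Prod.ext rfl hX, hmin⟩
  choose t q X γ ht hmin using hbase
  -- Pigeonhole: infinitely many `m`, finitely many pairs of a state and a top symbol.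
  obtain ⟨m, m', hne, heq⟩ := Finite.exists_ne_map_eq_of_infinite fun m => (q m, X m)
  simp only [Prod.mk.injEq] at heq
  -- The word `e dᵐ⁺¹` has `m + 2` letters, so above `γ m` at least `m + 2` symbols are needed.
  obtain ⟨N, hN⟩ := exists_height_ge (hinj m) ((γ m).length + (m + 2))
  obtain ⟨p, Y, -, h₁, hp⟩ := exists_upper_run hA (hstep m) (ht m) (hmin m) N
  obtain ⟨p', Y', -, h₂, hp'⟩ := exists_upper_run hA (hstep m') (ht m') (hmin m') N
  rw [← heq.1, ← heq.2] at hp'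
  obtain ⟨rfl, rfl⟩ := Prod.mk.inj (hd.path_unique hp hp')
  have hlen := hN (t m + N) (by omega)
  rw [h₁, List.length_append] at hlen
  obtain ⟨r, hr, β, hβ⟩ := (hacc m (t m + N) ([e] ++ List.replicate (m + 1) d)).2
    ⟨m + 1, t m + N + 1, by omega, by omega, .inr (by simp)⟩
  rw [h₁] at hβ
  -- The run on `e dᵐ⁺¹` is transplanted from `γ m` to `γ m'` beneath the same upper stack `Y`; its
  -- acceptance then forces `m = m'`.
  obtain ⟨β', hβ'⟩ := (hA.path_of_reaches hβ).exists_of_length_le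
    (by simp; omega) (γ m')
  have := (hacc m' (t m' + N) ([e] ++ List.replicate (m + 1) d)).1
    ⟨r, hr, β', _, h₂ ▸ hβ', by simp [List.reduceOption]⟩
  have := eq_of_mem_right h this
  omega

end Witness₁

lemma HRDPDA_subset_RDPDA (T : Type) : HRDPDA T ⊆ RDPDA T :=
  fun _ ⟨A, _, hA, hd, hL⟩ => ⟨A, hA, hd, hL⟩

theorem mainTheorem4 :
    (¬ (∀ (T : Type) [Finite T], FG T ⊆ HRDPDA T) ∧
      ¬ (∀ (T : Type) [Finite T], HRDPDA T ⊆ FG T)) ∧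
    (∀ (T : Type) [Finite T] (a b c d e : T), [a, b, c, d, e].Nodup →
      witness₁ a b c d e ∈ FG T ∧ witness₁ a b c d e ∈ DPDA T ∧
      witness₁ a b c d e ∉ RDPDA T ∧ witness₁ a b c d e ∉ HRDPDA T) ∧
    (∀ (T : Type) [Finite T] (a c : T), a ≠ c →
      witness₂ a c ∈ HRDPDA T ∧ witness₂ a c ∉ FG T) := by
  refine ⟨⟨fun h => ?_, fun h => ?_⟩, fun T _ a b c d e h => ?_, fun T _ a c h => ?_⟩
  · have hnodup : [(0 : Fin 5), 1, 2, 3, 4].Nodup := by decide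
    exact Witness₁.notMem_RDPDA hnodup
      (HRDPDA_subset_RDPDA _ (h (Fin 5) (Witness₁.mem_FG _ _ _ _ _ hnodup)))
  · exact witness₂_notMem_FG (by simp)
      (h Bool (Witness₂.mem_HRDPDA true false (by simp)))
  · exact ⟨Witness₁.mem_FG _ _ _ _ _ h, Witness₁.mem_DPDA _ _ _ _ _ h, Witness₁.notMem_RDPDA h,
      fun hmem => Witness₁.notMem_RDPDA h (HRDPDA_subset_RDPDA T hmem)⟩
  · exact ⟨Witness₂.mem_HRDPDA a c h, witness₂_notMem_FG h⟩
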